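/- Let $k\ge 1$ and let $\Sigma=\{\sigma_1,\dots,\sigma_k\}$ be an alphabet with $k$ letters. Consider the regular expressions $\alpha$ generated by the grammar $\alpha := \varepsilon \mid \sigma\in\Sigma \mid (\alpha+\alpha)\mid(\alpha\cdot\alpha)\mid(\alpha^\star)$. The size of an expression is its number of symbols, parentheses not counted. Write $\Sigma^\star$ for any expression $(\sigma_{i_1}+\cdots+\sigma_{i_k})^\star$ where $\sigma_{i_1},\dots,\sigma_{i_k}$ is a permutation of $\Sigma$ and the sum is bracketed in any way. Let $\mathrm{RE}_{na}$ be the set of those expressions in which no union $(\alpha_1+\alpha_2)$ has an expression $\Sigma^\star$ as one of its two operands. Let $[z^n]R_k(z)$ be the number of expressions of size $n$ in $\mathrm{RE}_{na}$, and $[z^n]L_k(z)$ the total number of letter occurrences in all these expressions. Put $$C_k=\binom{2k-2}{k-1}(k-1)!,\qquad p_k(z)=1-2z-(7+8k)z^2,\qquad h_k(z)=1-z-C_kz^{2k+1},$$ $$\Delta_k(z)=p_k(z)+4C_kz^{2k+1}h_k(z),\qquad g_k(z)=2-C_kz^{2k-1}\left(h_k(z)-C_kz^{2k+1}\right).$$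 Theorem. The polynomial $\Delta_k$ has a unique root $\eta_k$ in the open interval $\left(0,\frac1{\sqrt{8k+8}}\right)$, and one can write $\Delta_k(z)=\left(1-\frac z{\eta_k}\right)\psi_k(z)$ with $\psi_k\in\mathbb R[z]$. Moreover $\psi_k(\eta_k)\neq0$, $g_k(\eta_k)\ne 0$, and the asymptotic ratio of letters in the expressions in $\mathrm{RE}_{na}$ is given by $$\lim_{n\to\infty}\frac{[z^n]L_k(z)}{n\,[z^n]R_k(z)}=\frac{4k\,\eta_k^2\,g_k(\eta_k)}{\psi_k(\eta_k)}.$$ -/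

import Mathlib

open Polynomial Filter Topology

namespace REna

/-- The (tree-)size of a regular expression: its number of symbols, disregarding parentheses. -/
def size {A : Type} : RegularExpression A → ℕ
  | .zero => 1
  | .epsilon => 1
  | .char _ => 1
  | .plus e f => size e + size f + 1
  | .comp e f => size e + size f + 1
  | .star e => size e + 1

/-- The list of the letter occurrences in a regular expression, from left to right. -/
def letters {A : Type} : RegularExpression A → List A
  | .zero => []
  | .epsilon => []
  | .char a => [a]
  | .plus e f => letters e ++ letters f
  | .comp e f => letters e ++ letters f
  | .star e => letters e

/-- The alphabetic size of a regular expression: its number of letter occurrences. -/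
def alphSize {A : Type} (e : RegularExpression A) : ℕ := (letters e).length

/-- The expressions generated by the grammar
`β := ε | σ | (β + β) | (β · β) | (β⋆)`, i.e. those without the symbol `∅`. -/
def InGrammar {A : Type} : RegularExpression A → Prop
  | .zero => False
  | .epsilon => True
  | .char _ => True
  | .plus e f => InGrammar e ∧ InGrammar f
  | .comp e f => InGrammar e ∧ InGrammar f
  | .star e => InGrammar e

/-- The expression is a sum of letters, bracketed in any way. -/
def IsLetterSum {A : Type} : RegularExpression A → Prop
  | .char _ => True
  | .plus e f => IsLetterSum e ∧ IsLetterSum f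
  | _ => False

/-- The expression is of the form `(σ_{i₁} + ⋯ + σ_{iₖ})⋆`, bracketed in any way, where
`σ_{i₁}, …, σ_{iₖ}` is a permutation of the alphabet `Fin k`. -/
def IsSigmaStar {k : ℕ} : RegularExpression (Fin k) → Prop
  | .star e => IsLetterSum e ∧ (letters e).Perm (List.finRange k)
  | _ => False

/-- Somewhere in the expression there is a union one of whose two operands is
an expression `Σ⋆`. -/
def SigmaStarInUnion {k : ℕ} : RegularExpression (Fin k) → Prop
  | .zero => False
  | .epsilon => False
  | .char _ => False
  | .plus e f => IsSigmaStar e ∨ IsSigmaStar f ∨ SigmaStarInUnion e ∨ SigmaStarInUnion f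
  | .comp e f => SigmaStarInUnion e ∨ SigmaStarInUnion f
  | .star e => SigmaStarInUnion e

/-- The regular expressions over an alphabet of `k` letters in which `Σ⋆` does not occur
in a union. -/
def expressions (k : ℕ) : Set (RegularExpression (Fin k)) :=
  {e | InGrammar e ∧ ¬ SigmaStarInUnion e}

theorem finite_size_le (k n : ℕ) : {e : RegularExpression (Fin k) | size e ≤ n}.Finite := by
  induction n with
  | zero =>
    refine Set.finite_empty.subset ?_
    rintro (_ | _ | _ | _ | _ | _) h <;> simp [size] at h
  | succ n ih =>
    refine (((((Set.finite_singleton RegularExpression.zero).union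
      (Set.finite_singleton RegularExpression.epsilon)).union
      (Set.finite_range RegularExpression.char)).union
      (Set.Finite.image2 RegularExpression.plus ih ih)).union
      (Set.Finite.image2 RegularExpression.comp ih ih)).union
      (ih.image RegularExpression.star) |>.subset ?_
    rintro (_ | _ | a | ⟨e, f⟩ | ⟨e, f⟩ | e) h
    · simp
    · simp
    · simp
    · simp only [Set.mem_ofPred_eq, size] at h
      exact .inl (.inl (.inr ⟨e, by simp; omega, f, by simp; omega, rfl⟩))
    · simp only [Set.mem_ofPred_eq, size] at h
      exact .inl (.inr ⟨e, by simp; omega, f, by simp; omega, rfl⟩)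
    · simp only [Set.mem_ofPred_eq, size] at h
      exact .inr ⟨e, by simp; omega, rfl⟩

theorem finite_ofSize (k n : ℕ) : {e | e ∈ expressions k ∧ size e = n}.Finite :=
  (finite_size_le k n).subset fun _ h => h.2.le

/-- The finite set of the expressions of size `n` in which `Σ⋆` does not occur in a union. -/
noncomputable def ofSize (k n : ℕ) : Finset (RegularExpression (Fin k)) :=
  (finite_ofSize k n).toFinset

/-- The generating function `R_k(z)` of the number of expressions. -/
noncomputable def R (k : ℕ) : PowerSeries ℝ :=
  PowerSeries.mk fun n => ((ofSize k n).card : ℝ)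

/-- The generating function `L_k(z)` of the total number of letters:
its `n`-th coefficient is the number of letters in all the expressions of size `n`. -/
noncomputable def L (k : ℕ) : PowerSeries ℝ :=
  PowerSeries.mk fun n => ((∑ e ∈ ofSize k n, alphSize e : ℕ) : ℝ)

/-- The number `C_k` of expressions `Σ⋆`, for `k ≥ 1`. -/
def c (k : ℕ) : ℕ := (2 * k - 2).choose (k - 1) * (k - 1).factorial

/-- `p_k(z) = 1 - 2z - (7 + 8k) z²` -/
noncomputable def p (k : ℕ) : ℝ[X] := 1 - 2 * X - (7 + 8 * (k : ℝ[X])) * X ^ 2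

/-- `h_k(z) = 1 - z - C_k z^(2k+1)` -/
noncomputable def h (k : ℕ) : ℝ[X] := 1 - X - (c k : ℝ[X]) * X ^ (2 * k + 1)

/-- `Δ_k(z) = p_k(z) + 4 z^(2k+1) C_k h_k(z)` -/
noncomputable def Delta (k : ℕ) : ℝ[X] :=
  p k + 4 * X ^ (2 * k + 1) * (c k : ℝ[X]) * h k

/-- `g_k(z) = 2 - C_k z^(2k-1) (h_k(z) - C_k z^(2k+1))`, for `k ≥ 1` -/
noncomputable def g (k : ℕ) : ℝ[X] :=
  2 - (c k : ℝ[X]) * X ^ (2 * k - 1) * (h k - (c k : ℝ[X]) * X ^ (2 * k + 1))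

end REna

namespace REna

/-! Write `S = C_k z^(2k)` for the series of the expressions `Σ⋆`. Splitting an expression at its
outermost symbol gives `R = z(1 + k + (R - S)² + R² + R)`, because only a union restricts its
operands (`R_eq`). This is quadratic in `R` with discriminant `Δ_k`, so `D = 1 - z + 2zS - 4zR`
satisfies `D² = Δ_k`. Letter counts are additive, so `L` satisfies the linearised equation (`L_eq`),
and `2LD = k z g_k + k S D`.

Hence, up to finitely many coefficients, `L` is the polynomial `k z g_k / 2` times `1/D`. Likewise
`2D' = Δ_k'/D`, whose `n`-th coefficient is `-8(n+1)[zⁿ]R` for large `n`. Both sequences in the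
ratio are thus coefficients of a polynomial times the same series `Δ_k^(-1/2)`, and only the values
of the two polynomials at the dominant singularity matter.

Analytic input: with `r = 1/√(8k+8)`, the polynomial `Δ_k` differs from `p_k` on `|z| ≤ r` by a
small perturbation. Its zeros there have nonnegative real part, and on that half disc `|Δ_k(z) -
Δ_k(w)| ≥ |z - w|/2` (`norm_sub_le_norm_aeval_Delta_sub`). So `η` is the only complex zero in the
closed disc and is simple, and `ψ` has no zero there. Therefore `Δ_k^(-1/2) = (1 - z/η)^(-1/2) B`
with `B` absolutely convergent up to `r > η`. Tannery's theorem (`tendsto_coeff_invSqrt_mul`) gives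
`[zⁿ] P Δ_k^(-1/2) ~ P(η) B(η) a_n η^(-n)` when `P(η) ≠ 0`, where `a_n = binom(2n,n)/4ⁿ`. Since
`Δ_k'(η) = -ψ(η)/η`, the quotient is the stated limit. -/

theorem char_inj {A : Type} {a b : A} :
    RegularExpression.char a = .char b ↔ a = b :=
  ⟨fun h => by cases h; rfl, fun h => h ▸ rfl⟩

theorem plus_inj {A : Type} {e f e' f' : RegularExpression A} :
    RegularExpression.plus e f = .plus e' f' ↔ e = e' ∧ f = f' :=
  ⟨fun h => by cases h; exact ⟨rfl, rfl⟩, fun h => h.1 ▸ h.2 ▸ rfl⟩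

theorem comp_inj {A : Type} {e f e' f' : RegularExpression A} :
    RegularExpression.comp e f = .comp e' f' ↔ e = e' ∧ f = f' :=
  ⟨fun h => by cases h; exact ⟨rfl, rfl⟩, fun h => h.1 ▸ h.2 ▸ rfl⟩

theorem star_inj {A : Type} {e f : RegularExpression A} :
    RegularExpression.star e = .star f ↔ e = f :=
  ⟨fun h => by cases h; rfl, fun h => h ▸ rfl⟩

attribute [-simp] RegularExpression.zero_def RegularExpression.one_def
  RegularExpression.plus_def RegularExpression.comp_def

/-! ### Letter sums and the expressions `Σ⋆` -/

/-- The binary tree underlying a letter sum. -/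
def shape {A : Type} : RegularExpression A → BinaryTree Unit
  | .plus e f => .node () (shape e) (shape f)
  | _ => .nil

theorem IsLetterSum.length_letters {A : Type} {e : RegularExpression A} (he : IsLetterSum e) :
    (letters e).length = (shape e).numNodes + 1 := by
  induction e with
  | char a => simp [letters, shape]
  | plus e f ihe ihf =>
    simp only [letters, shape, List.length_append, BinaryTree.numNodes, ihe he.1, ihf he.2]
    omega
  | _ => exact he.elim

theorem IsLetterSum.size_add_one {A : Type} {e : RegularExpression A} (he : IsLetterSum e) :
    size e + 1 = 2 * (letters e).length := by
  induction e with
  | char a => simp [letters, size]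
  | plus e f ihe ihf =>
    have h1 := ihe he.1
    have h2 := ihf he.2
    simp only [letters, size, List.length_append]
    omega
  | _ => exact he.elim

theorem IsLetterSum.inGrammar {A : Type} {e : RegularExpression A} (he : IsLetterSum e) :
    InGrammar e := by
  induction e with
  | char a => trivial
  | plus e f ihe ihf => exact ⟨ihe he.1, ihf he.2⟩
  | _ => exact he.elim

theorem IsLetterSum.not_isSigmaStar {k : ℕ} {e : RegularExpression (Fin k)} (he : IsLetterSum e) :
    ¬ IsSigmaStar e := by
  cases e <;> simp_all [IsLetterSum, IsSigmaStar]

theorem IsLetterSum.not_sigmaStarInUnion {k : ℕ} {e : RegularExpression (Fin k)}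
    (he : IsLetterSum e) : ¬ SigmaStarInUnion e := by
  induction e with
  | char a => exact id
  | plus e f ihe ihf =>
    rintro (h | h | h | h)
    · exact he.1.not_isSigmaStar h
    · exact he.2.not_isSigmaStar h
    · exact ihe he.1 h
    · exact ihf he.2 h
  | _ => exact he.elim

/-- The shape fixes how many letters lie in each operand, so the word splits in only one way at
every union. -/
theorem IsLetterSum.ext {A : Type} {e f : RegularExpression A} (he : IsLetterSum e)
    (hf : IsLetterSum f) (hs : shape e = shape f) (hl : letters e = letters f) : e = f := by
  induction e generalizing f with
  | char a =>
    cases f with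
    | char b => simpa [letters, char_inj] using hl
    | plus f₁ f₂ => simp [shape] at hs
    | _ => exact hf.elim
  | plus e₁ e₂ ih₁ ih₂ =>
    cases f with
    | char b => simp [shape] at hs
    | plus f₁ f₂ =>
      simp only [shape, BinaryTree.node.injEq, true_and] at hs
      have hlen : (letters e₁).length = (letters f₁).length := by
        rw [he.1.length_letters, hf.1.length_letters, hs.1]
      obtain ⟨h₁, h₂⟩ := List.append_inj hl hlen
      rw [ih₁ he.1 hf.1 hs.1 h₁, ih₂ he.2 hf.2 hs.2 h₂]
    | _ => exact hf.elim
  | _ => exact he.elim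

theorem exists_isLetterSum {A : Type} (t : BinaryTree Unit) (l : List A)
    (hl : l.length = t.numNodes + 1) :
    ∃ e : RegularExpression A, IsLetterSum e ∧ shape e = t ∧ letters e = l := by
  induction t generalizing l with
  | nil =>
    obtain ⟨a, rfl⟩ := List.length_eq_one_iff.mp (by simpa using hl)
    exact ⟨.char a, trivial, rfl, rfl⟩
  | node u t₁ t₂ ih₁ ih₂ =>
    simp only [BinaryTree.numNodes] at hl
    obtain ⟨e₁, h₁, s₁, l₁⟩ := ih₁ (l.take (t₁.numNodes + 1)) (by simp; omega)
    obtain ⟨e₂, h₂, s₂, l₂⟩ := ih₂ (l.drop (t₁.numNodes + 1)) (by simp; omega)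
    exact ⟨.plus e₁ e₂, ⟨h₁, h₂⟩, by simp [shape, s₁, s₂], by simp [letters, l₁, l₂]⟩

theorem catalan_mul_factorial {k : ℕ} (hk : 1 ≤ k) : catalan (k - 1) * k.factorial = c k := by
  obtain ⟨m, rfl⟩ : ∃ m, k = m + 1 := ⟨k - 1, by omega⟩
  have h := succ_mul_catalan_eq_centralBinom m
  simp only [c, Nat.add_sub_cancel, Nat.factorial_succ]
  rw [show 2 * (m + 1) - 2 = 2 * m by omega, ← Nat.centralBinom_eq_two_mul_choose, ← h]
  ring

/-- A bracketing is a binary tree with `k - 1` nodes and the leaves carry a permutation of the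
alphabet. The two choices are independent, which gives `catalan (k - 1) * k!`. -/
theorem ncard_isSigmaStar {k : ℕ} (hk : 1 ≤ k) :
    {e : RegularExpression (Fin k) | IsSigmaStar e}.ncard = c k := by
  classical
  rw [← catalan_mul_factorial hk, ← BinaryTree.treesOfNumNodesEq_card_eq_catalan,
    show k.factorial = (List.finRange k).permutations.toFinset.card by
      rw [List.toFinset_card_of_nodup (List.nodup_permutations _ (List.nodup_finRange k)),
        List.length_permutations, List.length_finRange],
    ← Finset.card_product, ← Set.ncard_coe_finset]
  have key : ∀ e : RegularExpression (Fin k), IsSigmaStar e → ∃ f, e = .star f ∧ IsLetterSum f ∧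
      (letters f).Perm (List.finRange k) := by
    rintro (_ | _ | _ | _ | _ | f) he
    all_goals first | exact he.elim | exact ⟨f, rfl, he.1, he.2⟩
  -- The second branch is a dummy: by `key`, every expression counted is a star.
  refine Set.ncard_congr (fun e _ => match e with
    | .star f => (shape f, letters f)
    | _ => (.nil, [])) ?_ ?_ ?_
  · intro e he
    obtain ⟨f, rfl, hf, hp⟩ := key e he
    have h1 := hf.length_letters
    have h2 := hp.length_eq
    rw [List.length_finRange] at h2
    simp only [Finset.coe_product, Set.mem_prod, Finset.mem_coe, BinaryTree.mem_treesOfNumNodesEq,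
      List.mem_toFinset, List.mem_permutations]
    exact ⟨by omega, hp⟩
  · intro e e' he he' h
    obtain ⟨f, rfl, hf, -⟩ := key e he
    obtain ⟨f', rfl, hf', -⟩ := key e' he'
    simp only [Prod.mk.injEq] at h
    rw [hf.ext hf' h.1 h.2]
  · rintro ⟨t, l⟩ h
    simp only [Finset.coe_product, Set.mem_prod, Finset.mem_coe, BinaryTree.mem_treesOfNumNodesEq,
      List.mem_toFinset, List.mem_permutations] at h
    have h2 := h.2.length_eq
    rw [List.length_finRange] at h2
    obtain ⟨f, hf, rfl, rfl⟩ := exists_isLetterSum t l (by omega)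
    exact ⟨.star f, ⟨hf, h.2⟩, rfl⟩

theorem IsSigmaStar.alphSize_eq {k : ℕ} {e : RegularExpression (Fin k)} (he : IsSigmaStar e) :
    alphSize e = k := by
  cases e with
  | star f => simpa [alphSize, letters] using he.2.length_eq
  | _ => exact he.elim

theorem IsSigmaStar.size_eq {k : ℕ} {e : RegularExpression (Fin k)} (he : IsSigmaStar e) :
    size e = 2 * k := by
  have h := he.alphSize_eq
  cases e with
  | star f =>
    have h1 := he.1.size_add_one
    change size f + 1 = 2 * k
    rw [h1]
    exact congrArg (2 * ·) h
  | _ => exact he.elim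

theorem IsSigmaStar.mem_expressions {k : ℕ} {e : RegularExpression (Fin k)} (he : IsSigmaStar e) :
    e ∈ expressions k := by
  cases e with
  | star f => exact ⟨he.1.inGrammar, he.1.not_sigmaStarInUnion⟩
  | _ => exact he.elim

/-! ### The recursive structure of the expressions -/

theorem mem_ofSize {k n : ℕ} {e : RegularExpression (Fin k)} :
    e ∈ ofSize k n ↔ e ∈ expressions k ∧ size e = n := by
  simp [ofSize]

open Classical in
/-- The expressions `Σ⋆` of size `n`. -/
noncomputable def sigmaStars (k n : ℕ) : Finset (RegularExpression (Fin k)) :=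
  {e ∈ ofSize k n | IsSigmaStar e}

open Classical in
/-- The expressions of size `n` which may be an operand of a union. -/
noncomputable def operands (k n : ℕ) : Finset (RegularExpression (Fin k)) :=
  {e ∈ ofSize k n | ¬ IsSigmaStar e}

theorem mem_operands {k n : ℕ} {e : RegularExpression (Fin k)} :
    e ∈ operands k n ↔ e ∈ ofSize k n ∧ ¬ IsSigmaStar e := by
  simp [operands]

theorem sum_operands (k n : ℕ) (w : RegularExpression (Fin k) → ℝ) :
    ∑ e ∈ operands k n, w e = ∑ e ∈ ofSize k n, w e - ∑ e ∈ sigmaStars k n, w e := by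
  classical
  rw [eq_sub_iff_add_eq', sigmaStars, operands]
  exact Finset.sum_filter_add_sum_filter_not _ _ _

theorem card_sigmaStars {k : ℕ} (hk : 1 ≤ k) (n : ℕ) :
    (sigmaStars k n).card = if n = 2 * k then c k else 0 := by
  classical
  split_ifs with h
  · rw [← ncard_isSigmaStar hk, ← Set.ncard_coe_finset]
    congr 1
    ext e
    simp only [sigmaStars, Finset.coe_filter, mem_ofSize, Set.mem_ofPred_eq, and_iff_right_iff_imp]
    exact fun he => ⟨he.mem_expressions, he.size_eq.trans h.symm⟩
  · rw [Finset.card_eq_zero, sigmaStars, Finset.filter_eq_empty_iff]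
    exact fun e he hs => h ((mem_ofSize.mp he).2.symm.trans hs.size_eq)

theorem sum_alphSize_sigmaStars (k n : ℕ) :
    ∑ e ∈ sigmaStars k n, (alphSize e : ℝ) = k * (sigmaStars k n).card := by
  classical
  rw [Finset.sum_congr rfl (g := fun _ => (k : ℝ)), Finset.sum_const, nsmul_eq_mul, mul_comm]
  intro e he
  rw [sigmaStars, Finset.mem_filter] at he
  rw [he.2.alphSize_eq]

theorem ofSize_zero (k : ℕ) : ofSize k 0 = ∅ := by
  rw [Finset.eq_empty_iff_forall_notMem]
  intro e he
  have := (mem_ofSize.mp he).2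
  cases e <;> simp [size] at this

/-- The weight is arbitrary so that one decomposition by outermost symbol yields both functional
equations: weight `1` for `R`, the number of letters for `L`. -/
theorem sum_ofSize_succ (k n : ℕ) (w : RegularExpression (Fin k) → ℝ) :
    ∑ e ∈ ofSize k (n + 1), w e =
      (if n = 0 then w .epsilon + ∑ a, w (.char a) else 0)
      + ∑ ij ∈ Finset.HasAntidiagonal.antidiagonal n, ∑ e ∈ operands k ij.1, ∑ f ∈ operands k ij.2, w (.plus e f)
      + ∑ ij ∈ Finset.HasAntidiagonal.antidiagonal n, ∑ e ∈ ofSize k ij.1, ∑ f ∈ ofSize k ij.2, w (.comp e f)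
      + ∑ e ∈ ofSize k n, w (.star e) := by
  classical
  let E := RegularExpression (Fin k)
  let B : Finset E := if n = 0 then insert .epsilon (Finset.univ.image .char) else ∅
  let pairs (T : ℕ → Finset E) : Finset ((_ : ℕ × ℕ) × (E × E)) :=
    (Finset.HasAntidiagonal.antidiagonal n).sigma fun ij => T ij.1 ×ˢ T ij.2
  let P : Finset E := (pairs (operands k)).image fun x => .plus x.2.1 x.2.2
  let Q : Finset E := (pairs (ofSize k)).image fun x => .comp x.2.1 x.2.2
  let S : Finset E := (ofSize k n).image .star
  have hunion : ofSize k (n + 1) = ((B ∪ P) ∪ Q) ∪ S := by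
    ext e
    cases e with
    | zero => simp [B, P, Q, S, mem_ofSize, expressions, InGrammar]; split_ifs <;> simp
    | epsilon =>
      simp [B, P, Q, S, mem_ofSize, expressions, InGrammar, SigmaStarInUnion, size]
      split_ifs <;> simp <;> omega
    | char a =>
      simp [B, P, Q, S, mem_ofSize, expressions, InGrammar, SigmaStarInUnion, size]
      split_ifs <;> simp <;> omega
    | plus e f =>
      have hB : RegularExpression.plus e f ∉ B := by
        simp only [B]; split_ifs <;> simp
      simp [hB, plus_inj, P, Q, S, mem_ofSize, mem_operands, pairs, expressions, InGrammar,
        SigmaStarInUnion, size]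
      tauto
    | comp e f =>
      have hB : RegularExpression.comp e f ∉ B := by
        simp only [B]; split_ifs <;> simp
      simp [hB, comp_inj, P, Q, S, mem_ofSize, pairs, expressions, InGrammar,
        SigmaStarInUnion, size]
      tauto
    | star e =>
      have hB : RegularExpression.star e ∉ B := by
        simp only [B]; split_ifs <;> simp
      simp [hB, star_inj, P, Q, S, mem_ofSize, pairs, expressions, InGrammar,
        SigmaStarInUnion, size]
  have hBmem : ∀ e ∈ B, e = .epsilon ∨ ∃ a, e = .char a := by
    intro e he
    simp only [B] at he
    split_ifs at he with h0
    · simpa [eq_comm] using he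
    · simp at he
  have hd1 : Disjoint B P := by
    rw [Finset.disjoint_left]
    intro e he hP
    obtain ⟨x, -, rfl⟩ := Finset.mem_image.mp hP
    simpa using hBmem _ he
  have hd2 : Disjoint (B ∪ P) Q := by
    rw [Finset.disjoint_right]
    intro e hQ he
    obtain ⟨x, -, rfl⟩ := Finset.mem_image.mp hQ
    rcases Finset.mem_union.mp he with he | he
    · simpa using hBmem _ he
    · simp [P] at he
  have hd3 : Disjoint ((B ∪ P) ∪ Q) S := by
    rw [Finset.disjoint_right]
    intro e hS he
    obtain ⟨x, -, rfl⟩ := Finset.mem_image.mp hS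
    rcases Finset.mem_union.mp he with he | he
    · rcases Finset.mem_union.mp he with he | he
      · simpa using hBmem _ he
      · simp [P] at he
    · simp [Q] at he
  -- The operands determine their sizes, hence the index `(i, j)`, so no expression is produced
  -- twice.
  have hinj (T : ℕ → Finset E) (hT : ∀ i, ∀ e ∈ T i, size e = i) (op : E → E → E)
      (hop : ∀ e f e' f', op e f = op e' f' → e = e' ∧ f = f') :
      Set.InjOn (fun x : (_ : ℕ × ℕ) × (E × E) => op x.2.1 x.2.2) (pairs T) := by
    rintro ⟨⟨i, j⟩, e, f⟩ hx ⟨⟨i', j'⟩, e', f'⟩ hy h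
    simp only [pairs, Finset.mem_coe, Finset.mem_sigma, Finset.mem_product] at hx hy
    obtain ⟨rfl, rfl⟩ := hop _ _ _ _ h
    have h1 := hT _ _ hx.2.1
    have h2 := hT _ _ hx.2.2
    have h3 := hT _ _ hy.2.1
    have h4 := hT _ _ hy.2.2
    simp only at h1 h2 h3 h4
    subst h1 h2 h3 h4
    rfl
  rw [hunion, Finset.sum_union hd3, Finset.sum_union hd2, Finset.sum_union hd1]
  congr 1
  · congr 1
    · congr 1
      · simp only [B]
        split_ifs
        · rw [Finset.sum_insert (by simp), Finset.sum_image (fun a _ b _ h => char_inj.mp h)]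
        · simp
      · rw [Finset.sum_image (hinj _ (fun i e he => (mem_ofSize.mp (mem_operands.mp he).1).2)
          _ (fun _ _ _ _ => plus_inj.mp)), Finset.sum_sigma]
        exact Finset.sum_congr rfl fun ij _ => Finset.sum_product _ _ _
    · rw [Finset.sum_image (hinj _ (fun i e he => (mem_ofSize.mp he).2) _ (fun _ _ _ _ => comp_inj.mp)),
        Finset.sum_sigma]
      exact Finset.sum_congr rfl fun ij _ => Finset.sum_product _ _ _
  · exact Finset.sum_image (fun a _ b _ h => star_inj.mp h)

/-! ### The functional equations -/

/-- The generating function of the expressions `Σ⋆`. -/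
noncomputable def sigmaSeries (k : ℕ) : PowerSeries ℝ :=
  PowerSeries.C (c k : ℝ) * PowerSeries.X ^ (2 * k)

theorem coeff_sigmaSeries {k : ℕ} (hk : 1 ≤ k) (n : ℕ) :
    PowerSeries.coeff n (sigmaSeries k) = ((sigmaStars k n).card : ℝ) := by
  rw [card_sigmaStars hk, sigmaSeries, PowerSeries.coeff_C_mul, PowerSeries.coeff_X_pow]
  split_ifs <;> simp

theorem coeff_R (k n : ℕ) : PowerSeries.coeff n (R k) = ∑ e ∈ ofSize k n, (1 : ℝ) := by
  simp [R]

theorem coeff_L (k n : ℕ) : PowerSeries.coeff n (L k) = ∑ e ∈ ofSize k n, (alphSize e : ℝ) := by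
  simp [L]

theorem coeff_R_sub {k : ℕ} (hk : 1 ≤ k) (n : ℕ) :
    PowerSeries.coeff n (R k - sigmaSeries k) = ∑ e ∈ operands k n, (1 : ℝ) := by
  rw [map_sub, coeff_R, coeff_sigmaSeries hk, sum_operands]
  simp

theorem coeff_L_sub {k : ℕ} (hk : 1 ≤ k) (n : ℕ) :
    PowerSeries.coeff n (L k - PowerSeries.C (k : ℝ) * sigmaSeries k) =
      ∑ e ∈ operands k n, (alphSize e : ℝ) := by
  rw [map_sub, coeff_L, PowerSeries.coeff_C_mul, coeff_sigmaSeries hk, sum_operands,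
    sum_alphSize_sigmaStars]

theorem R_eq {k : ℕ} (hk : 1 ≤ k) :
    R k = PowerSeries.X * (1 + PowerSeries.C (k : ℝ) + (R k - sigmaSeries k) ^ 2 + R k ^ 2 + R k) := by
  ext n
  cases n with
  | zero => simp [coeff_R, ofSize_zero, -PowerSeries.coeff_zero_eq_constantCoeff, PowerSeries.coeff_zero_X_mul]
  | succ n =>
    rw [PowerSeries.coeff_succ_X_mul, coeff_R, sum_ofSize_succ]
    simp only [map_add, sq, PowerSeries.coeff_mul, coeff_R_sub hk, coeff_R, Finset.sum_mul_sum,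
      mul_one, PowerSeries.coeff_one, PowerSeries.coeff_C]
    congr 3
    split_ifs <;> simp

theorem L_eq {k : ℕ} (hk : 1 ≤ k) :
    L k = PowerSeries.X * (PowerSeries.C (k : ℝ)
      + 2 * (R k - sigmaSeries k) * (L k - PowerSeries.C (k : ℝ) * sigmaSeries k)
      + 2 * R k * L k + L k) := by
  -- The factors `1` turn each double sum into a letter sum times a counting sum, which is the form
  -- of the terms in a Cauchy product of an `L`-series and an `R`-series.
  have hplus (e f : RegularExpression (Fin k)) :
      (alphSize (.plus e f) : ℝ) = alphSize e * 1 + 1 * alphSize f := by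
    simp [alphSize, letters]
  have hcomp (e f : RegularExpression (Fin k)) :
      (alphSize (.comp e f) : ℝ) = alphSize e * 1 + 1 * alphSize f := by
    simp [alphSize, letters]
  have hstar (e : RegularExpression (Fin k)) : alphSize (.star e) = alphSize e := rfl
  have hchar (a : Fin k) : alphSize (.char a) = 1 := rfl
  have heps : alphSize (.epsilon : RegularExpression (Fin k)) = 0 := rfl
  rw [show 2 * (R k - sigmaSeries k) * (L k - PowerSeries.C (k : ℝ) * sigmaSeries k) =
      (L k - PowerSeries.C (k : ℝ) * sigmaSeries k) * (R k - sigmaSeries k)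
      + (R k - sigmaSeries k) * (L k - PowerSeries.C (k : ℝ) * sigmaSeries k) by ring,
    show 2 * R k * L k = L k * R k + R k * L k by ring]
  ext n
  cases n with
  | zero => simp [coeff_L, ofSize_zero, -PowerSeries.coeff_zero_eq_constantCoeff, PowerSeries.coeff_zero_X_mul]
  | succ n =>
    rw [PowerSeries.coeff_succ_X_mul, coeff_L, sum_ofSize_succ]
    simp only [map_add, PowerSeries.coeff_mul, coeff_R_sub hk, coeff_L_sub hk, coeff_R, coeff_L,
      Finset.sum_mul_sum, PowerSeries.coeff_C, hplus, hcomp, hstar, hchar, heps,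
      Finset.sum_add_distrib]
    congr 3
    split_ifs <;> simp

/-! ### The roots of `Δ_k` in the disc of radius `1/√(8k+8)` -/

/-- The radius `1/√(8k+8)`. -/
noncomputable def radius (k : ℕ) : ℝ := 1 / √(8 * (k : ℝ) + 8)

theorem radius_pos (k : ℕ) : 0 < radius k := by
  unfold radius
  positivity

theorem radius_sq (k : ℕ) : (8 * (k : ℝ) + 8) * radius k ^ 2 = 1 := by
  rw [radius, div_pow, Real.sq_sqrt (by positivity)]
  field_simp

theorem radius_le {k : ℕ} (hk : 1 ≤ k) : radius k ≤ 1 / 4 := by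
  have h1 := radius_sq k
  have h2 := radius_pos k
  have h3 : (1 : ℝ) ≤ k := by exact_mod_cast hk
  nlinarith [sq_nonneg (radius k)]

theorem c_le (k : ℕ) : c k ≤ (8 * k + 8) ^ (k - 1) := by
  calc c k ≤ 4 ^ (k - 1) * (k - 1) ^ (k - 1) := by
        rw [c, show 2 * k - 2 = 2 * (k - 1) by omega, ← Nat.centralBinom_eq_two_mul_choose]
        exact Nat.mul_le_mul (Nat.centralBinom_le_four_pow _) (Nat.factorial_le_pow _)
    _ = (4 * (k - 1)) ^ (k - 1) := (mul_pow _ _ _).symm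
    _ ≤ (8 * k + 8) ^ (k - 1) := Nat.pow_le_pow_left (by omega) _

/-- The crude bound `C_k ≤ r^(-2(k-1))` is enough. It makes `C_k z^(2k+1)` at most `r³` on the disc,
so that `Δ_k` is a small perturbation of `p_k`. -/
theorem c_mul_radius_pow_le {k : ℕ} (hk : 1 ≤ k) : c k * radius k ^ (2 * k) ≤ radius k ^ 2 := by
  have h1 : (c k : ℝ) ≤ (8 * (k : ℝ) + 8) ^ (k - 1) := by exact_mod_cast c_le k
  have h2 : (8 * (k : ℝ) + 8) ^ (k - 1) * radius k ^ (2 * (k - 1)) = 1 := by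
    rw [pow_mul, ← mul_pow, radius_sq, one_pow]
  have h3 : radius k ^ (2 * k) = radius k ^ (2 * (k - 1)) * radius k ^ 2 := by
    rw [← pow_add]
    congr 1
    omega
  have h4 := radius_pos k
  calc c k * radius k ^ (2 * k) ≤ (8 * (k : ℝ) + 8) ^ (k - 1) * radius k ^ (2 * k) := by gcongr
    _ = radius k ^ 2 := by rw [h3, ← mul_assoc, h2, one_mul]

theorem norm_pow_sub_pow_le {z w : ℂ} {r : ℝ} (hz : ‖z‖ ≤ r) (hw : ‖w‖ ≤ r) (n : ℕ) :
    ‖z ^ (n + 1) - w ^ (n + 1)‖ ≤ (n + 1) * r ^ n * ‖z - w‖ := by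
  have hr : 0 ≤ r := (norm_nonneg z).trans hz
  induction n with
  | zero => simp
  | succ n ih =>
    calc ‖z ^ (n + 1 + 1) - w ^ (n + 1 + 1)‖
        = ‖z * (z ^ (n + 1) - w ^ (n + 1)) + w ^ (n + 1) * (z - w)‖ := by ring_nf
      _ ≤ ‖z‖ * ‖z ^ (n + 1) - w ^ (n + 1)‖ + ‖w‖ ^ (n + 1) * ‖z - w‖ := by
        rw [← norm_pow, ← norm_mul, ← norm_mul]
        exact norm_add_le _ _
      _ ≤ r * ((n + 1) * r ^ n * ‖z - w‖) + r ^ (n + 1) * ‖z - w‖ := by gcongr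
      _ = ((n + 1 : ℕ) + 1) * r ^ (n + 1) * ‖z - w‖ := by push_cast; ring

theorem aeval_Delta (k : ℕ) (z : ℂ) :
    aeval z (Delta k) = 1 - 2 * z - (7 + 8 * k) * z ^ 2
      + 4 * (c k * z ^ (2 * k + 1) * (1 - z - c k * z ^ (2 * k + 1))) := by
  simp [Delta, p, h, aeval_def, eval₂_ofNat]
  ring

theorem eval_Delta (k : ℕ) (x : ℝ) :
    (Delta k).eval x = 1 - 2 * x - (7 + 8 * k) * x ^ 2
      + 4 * (c k * x ^ (2 * k + 1) * (1 - x - c k * x ^ (2 * k + 1))) := by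
  simp [Delta, p, h]
  ring

theorem norm_c_mul_pow_le {k : ℕ} (hk : 1 ≤ k) {z : ℂ} (hz : ‖z‖ ≤ radius k) :
    ‖(c k : ℂ) * z ^ (2 * k + 1)‖ ≤ radius k ^ 3 := by
  have h1 := radius_pos k
  rw [norm_mul, norm_pow, Complex.norm_natCast]
  calc (c k : ℝ) * ‖z‖ ^ (2 * k + 1) ≤ c k * radius k ^ (2 * k + 1) := by gcongr
    _ = c k * radius k ^ (2 * k) * radius k := by ring
    _ ≤ radius k ^ 2 * radius k := by gcongr; exact c_mul_radius_pow_le hk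
    _ = radius k ^ 3 := by ring

theorem norm_one_sub_sub_le {k : ℕ} (hk : 1 ≤ k) {z u : ℂ} (hz : ‖z‖ ≤ radius k)
    (hu : ‖u‖ ≤ radius k ^ 3) : ‖1 - z - u‖ ≤ 5 / 4 + 1 / 64 := by
  have h3 : radius k ^ 3 ≤ (1 / 4) ^ 3 := by
    have := radius_le hk
    have := radius_pos k
    gcongr
  calc ‖1 - z - u‖ ≤ ‖(1 : ℂ)‖ + ‖z‖ + ‖u‖ :=
        (norm_sub_le _ _).trans (by gcongr; exact norm_sub_le _ _)
    _ ≤ 5 / 4 + 1 / 64 := by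
      rw [norm_one]
      linarith [radius_le hk]

/-- With `s = 1/r`, `p_k = (1 - (1+s)z)(1 + (s-1)z)`. The second factor stays away from `0` on the
disc, so a zero of `Δ_k` must make the first factor small, which keeps it near `1/(1+s)`. -/
theorem re_nonneg_of_aeval_Delta_eq_zero {k : ℕ} (hk : 1 ≤ k) {z : ℂ} (hz : ‖z‖ ≤ radius k)
    (h0 : aeval z (Delta k) = 0) : 0 ≤ z.re := by
  set r := radius k with hr
  have hr0 : 0 < r := radius_pos k
  have hr4 : r ≤ 1 / 4 := radius_le hk
  obtain ⟨s, hs⟩ : ∃ s : ℝ, s * r = 1 := ⟨r⁻¹, inv_mul_cancel₀ hr0.ne'⟩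
  have hs2 : s ^ 2 = 8 * k + 8 := by
    have h1 := radius_sq k
    rw [← hr] at h1
    have h2 : s ^ 2 * r ^ 2 = 1 := by rw [← mul_pow, hs, one_pow]
    exact mul_right_cancel₀ (pow_ne_zero 2 hr0.ne') (h2.trans h1.symm)
  have hs4 : 4 ≤ s := by nlinarith
  have hsC : (s : ℂ) ^ 2 = 8 * k + 8 := by exact_mod_cast congrArg ((↑) : ℝ → ℂ) hs2
  set u : ℂ := c k * z ^ (2 * k + 1) with hu
  have hu3 : ‖u‖ ≤ r ^ 3 := norm_c_mul_pow_le hk hz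
  have hfac : (1 - (1 + (s : ℂ)) * z) * (1 + ((s : ℂ) - 1) * z) = -(4 * (u * (1 - z - u))) := by
    rw [aeval_Delta, ← hu] at h0
    linear_combination h0 - z ^ 2 * hsC
  -- The bound is `1 - (s - 1) r`, which equals `r` because `s r = 1`.
  have hlow : r ≤ ‖1 + ((s : ℂ) - 1) * z‖ := by
    have h1 : ‖((s : ℂ) - 1) * z‖ ≤ (s - 1) * r := by
      rw [norm_mul]
      have : ‖(s : ℂ) - 1‖ = s - 1 := by
        rw [← Complex.ofReal_one, ← Complex.ofReal_sub, Complex.norm_real, Real.norm_of_nonneg]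
        linarith
      rw [this]
      gcongr
      linarith
    have h2 := norm_sub_le (1 + ((s : ℂ) - 1) * z) (((s : ℂ) - 1) * z)
    rw [add_sub_cancel_right, norm_one] at h2
    nlinarith
  have hup : ‖1 - (1 + (s : ℂ)) * z‖ * r ≤ 4 * (r ^ 3 * (5 / 4 + 1 / 64)) := by
    calc ‖1 - (1 + (s : ℂ)) * z‖ * r ≤ ‖1 - (1 + (s : ℂ)) * z‖ * ‖1 + ((s : ℂ) - 1) * z‖ := by
          gcongr
      _ = 4 * (‖u‖ * ‖1 - z - u‖) := by
        rw [← norm_mul, hfac, norm_neg, norm_mul, norm_mul]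
        simp
      _ ≤ 4 * (r ^ 3 * (5 / 4 + 1 / 64)) := by
        gcongr
        exact norm_one_sub_sub_le hk hz hu3
  have hlt : ‖1 - (1 + (s : ℂ)) * z‖ ≤ 1 := by
    have h1 : ‖1 - (1 + (s : ℂ)) * z‖ ≤ 4 * (r ^ 2 * (5 / 4 + 1 / 64)) :=
      le_of_mul_le_mul_right (by linarith [hup, show 4 * (r ^ 2 * (5 / 4 + 1 / 64)) * r =
        4 * (r ^ 3 * (5 / 4 + 1 / 64)) by ring]) hr0
    nlinarith
  have hre := (Complex.re_le_norm _).trans hlt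
  have : (1 - (1 + (s : ℂ)) * z).re = 1 - (1 + s) * z.re := by simp
  rw [this] at hre
  by_contra! hneg
  nlinarith

/-- The difference of the `p_k` parts is `-(z - w)(2 + (7+8k)(z + w))`, of modulus at least `2|z -
w|` on the right half plane. The perturbation has Lipschitz constant at most `4 · 3/8 = 3/2`. The
resulting inequality gives both uniqueness and simplicity of the zero. -/
theorem norm_sub_le_norm_aeval_Delta_sub {k : ℕ} (hk : 1 ≤ k) {z w : ℂ} (hz : ‖z‖ ≤ radius k)
    (hw : ‖w‖ ≤ radius k) (hz0 : 0 ≤ z.re) (hw0 : 0 ≤ w.re) :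
    1 / 2 * ‖z - w‖ ≤ ‖aeval z (Delta k) - aeval w (Delta k)‖ := by
  have hr0 : 0 < radius k := radius_pos k
  have hr4 : radius k ≤ 1 / 4 := radius_le hk
  rw [aeval_Delta, aeval_Delta]
  set u : ℂ := c k * z ^ (2 * k + 1) with hu
  set v : ℂ := c k * w ^ (2 * k + 1) with hv
  have hu3 : ‖u‖ ≤ radius k ^ 3 := norm_c_mul_pow_le hk hz
  have hv3 : ‖v‖ ≤ radius k ^ 3 := norm_c_mul_pow_le hk hw
  have h64 : radius k ^ 3 ≤ 1 / 64 := by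
    calc radius k ^ 3 ≤ (1 / 4) ^ 3 := by gcongr
      _ = 1 / 64 := by norm_num
  have huv : ‖u - v‖ ≤ 1 / 4 * ‖z - w‖ := by
    rw [hu, hv, ← mul_sub, norm_mul, Complex.norm_natCast]
    calc (c k : ℝ) * ‖z ^ (2 * k + 1) - w ^ (2 * k + 1)‖
        ≤ c k * (((2 * k : ℕ) + 1) * radius k ^ (2 * k) * ‖z - w‖) := by
          gcongr
          exact norm_pow_sub_pow_le hz hw _
      _ = (2 * k + 1) * (c k * radius k ^ (2 * k)) * ‖z - w‖ := by push_cast; ring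
      _ ≤ (2 * k + 1) * radius k ^ 2 * ‖z - w‖ := by
        gcongr
        exact c_mul_radius_pow_le hk
      -- `(2k+1) r² = (2k+1)/(8k+8) ≤ 1/4`.
      _ ≤ 1 / 4 * ‖z - w‖ := by
        gcongr
        nlinarith [radius_sq k, sq_nonneg (radius k)]
  have hq : ‖u * (1 - z - u) - v * (1 - w - v)‖ ≤ 3 / 8 * ‖z - w‖ := by
    calc ‖u * (1 - z - u) - v * (1 - w - v)‖
        = ‖(u - v) * (1 - z - u) - v * ((z - w) + (u - v))‖ := by ring_nf
      _ ≤ ‖u - v‖ * ‖1 - z - u‖ + ‖v‖ * (‖z - w‖ + ‖u - v‖) := by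
        refine (norm_sub_le _ _).trans ?_
        rw [norm_mul, norm_mul]
        gcongr
        exact norm_add_le _ _
      _ ≤ 1 / 4 * ‖z - w‖ * (5 / 4 + 1 / 64) + 1 / 64 * (‖z - w‖ + 1 / 4 * ‖z - w‖) := by
        have := norm_one_sub_sub_le hk hz hu3
        have := hv3.trans h64
        gcongr
      _ ≤ 3 / 8 * ‖z - w‖ := by nlinarith [norm_nonneg (z - w)]
  have hlin : 2 * ‖z - w‖ ≤ ‖(z - w) * (2 + (7 + 8 * k) * (z + w))‖ := by
    rw [norm_mul, mul_comm]
    gcongr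
    refine le_trans ?_ (Complex.re_le_norm _)
    have : (2 + (7 + 8 * (k : ℂ)) * (z + w)).re = 2 + (7 + 8 * k) * (z.re + w.re) := by
      simp
    rw [this]
    have : 0 ≤ (7 + 8 * (k : ℝ)) * (z.re + w.re) := by positivity
    linarith
  have hsub := norm_sub_le
    ((1 - 2 * z - (7 + 8 * k) * z ^ 2 + 4 * (u * (1 - z - u)))
      - (1 - 2 * w - (7 + 8 * k) * w ^ 2 + 4 * (v * (1 - w - v))))
    (4 * (u * (1 - z - u) - v * (1 - w - v)))
  rw [show ((1 - 2 * z - (7 + 8 * k) * z ^ 2 + 4 * (u * (1 - z - u)))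
      - (1 - 2 * w - (7 + 8 * k) * w ^ 2 + 4 * (v * (1 - w - v))))
      - 4 * (u * (1 - z - u) - v * (1 - w - v)) = -((z - w) * (2 + (7 + 8 * k) * (z + w))) by ring,
    norm_neg, norm_mul (4 : ℂ)] at hsub
  rw [show ‖(4 : ℂ)‖ = 4 by norm_num] at hsub
  linarith

theorem eq_of_aeval_Delta_eq_zero {k : ℕ} (hk : 1 ≤ k) {z w : ℂ} (hz : ‖z‖ ≤ radius k)
    (hw : ‖w‖ ≤ radius k) (hz0 : aeval z (Delta k) = 0) (hw0 : aeval w (Delta k) = 0) : z = w := by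
  have h := norm_sub_le_norm_aeval_Delta_sub hk hz hw
    (re_nonneg_of_aeval_Delta_eq_zero hk hz hz0) (re_nonneg_of_aeval_Delta_eq_zero hk hw hw0)
  rw [hz0, hw0, sub_zero, norm_zero] at h
  have : ‖z - w‖ = 0 := le_antisymm (by linarith) (norm_nonneg _)
  exact sub_eq_zero.mp (norm_eq_zero.mp this)

theorem aeval_ofReal_Delta (k : ℕ) (x : ℝ) :
    aeval (x : ℂ) (Delta k) = ((Delta k).eval x : ℝ) := by
  rw [← Complex.coe_algebraMap, aeval_algebraMap_apply, coe_aeval_eq_eval]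

theorem exists_root_Delta {k : ℕ} (hk : 1 ≤ k) :
    ∃ η ∈ Set.Ioo 0 (radius k), (Delta k).eval η = 0 := by
  have hr0 : 0 < radius k := radius_pos k
  have hr4 : radius k ≤ 1 / 4 := radius_le hk
  have h0 : (Delta k).eval 0 = 1 := by simp [eval_Delta]
  have hr : (Delta k).eval (radius k) < 0 := by
    rw [eval_Delta]
    set u := (c k : ℝ) * radius k ^ (2 * k + 1) with hu
    have hu0 : 0 ≤ u := by positivity
    have hu3 : u ≤ radius k ^ 3 := by
      calc u = c k * radius k ^ (2 * k) * radius k := by rw [hu]; ring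
        _ ≤ radius k ^ 2 * radius k := by gcongr; exact c_mul_radius_pow_le hk
        _ = radius k ^ 3 := by ring
    have h1 := radius_sq k
    have h2 : u * (1 - radius k - u) ≤ radius k ^ 3 := by nlinarith
    have h3 : radius k ^ 3 ≤ radius k * (1 / 16) := by
      calc radius k ^ 3 = radius k * (radius k) ^ 2 := by ring
        _ ≤ radius k * (1 / 4) ^ 2 := by gcongr
        _ = radius k * (1 / 16) := by norm_num
    nlinarith
  obtain ⟨η, hη, hη0⟩ := intermediate_value_Icc' hr0.le (Delta k).continuous.continuousOn
    (show (0 : ℝ) ∈ Set.Icc ((Delta k).eval (radius k)) ((Delta k).eval 0) by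
      rw [h0]; exact ⟨hr.le, zero_le_one⟩)
  refine ⟨η, ⟨lt_of_le_of_ne hη.1 ?_, lt_of_le_of_ne hη.2 ?_⟩, hη0⟩
  · rintro rfl
    linarith
  · rintro rfl
    linarith

theorem norm_ofReal_le_radius {k : ℕ} {x : ℝ} (hx : x ∈ Set.Ioo 0 (radius k)) :
    ‖(x : ℂ)‖ ≤ radius k := by
  rw [Complex.norm_real, Real.norm_of_nonneg hx.1.le]
  exact hx.2.le

/-- Dividing the lower Lipschitz bound at `η` by `η - x` bounds `|ψ(x)|` below by `η/2` for `x < η`;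
let `x` tend to `η`. -/
theorem eval_ne_zero_of_Delta_eq {k : ℕ} (hk : 1 ≤ k) {η : ℝ} {ψ : ℝ[X]}
    (hη : η ∈ Set.Ioo 0 (radius k)) (hη0 : (Delta k).eval η = 0)
    (hψ : Delta k = (1 - C η⁻¹ * X) * ψ) : ψ.eval η ≠ 0 := by
  have hbound : ∀ x ∈ Set.Ioo 0 η, 1 / 2 * η ≤ |ψ.eval x| := by
    intro x hx
    have hx' : x ∈ Set.Ioo 0 (radius k) := ⟨hx.1, hx.2.trans hη.2⟩
    have h := norm_sub_le_norm_aeval_Delta_sub hk (norm_ofReal_le_radius hη)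
      (norm_ofReal_le_radius hx') (by simpa using hη.1.le) (by simpa using hx.1.le)
    rw [aeval_ofReal_Delta, aeval_ofReal_Delta, hη0, Complex.ofReal_zero, zero_sub, norm_neg,
      ← Complex.ofReal_sub, Complex.norm_real, Complex.norm_real, Real.norm_eq_abs,
      Real.norm_eq_abs, hψ, abs_of_pos (sub_pos.mpr hx.2)] at h
    simp only [eval_mul, eval_sub, eval_one, eval_C, eval_X, abs_mul] at h
    have h1 : 1 - η⁻¹ * x = η⁻¹ * (η - x) := by
      have := hη.1.ne'
      field_simp
    rw [h1, abs_mul, abs_of_pos (inv_pos.mpr hη.1), abs_of_pos (sub_pos.mpr hx.2)] at h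
    have h2 : 0 < η - x := sub_pos.mpr hx.2
    have h3 : 1 / 2 * (η - x) ≤ (η⁻¹ * |ψ.eval x|) * (η - x) := by linarith
    have h4 := le_of_mul_le_mul_right h3 h2
    rwa [inv_mul_eq_div, le_div_iff₀ hη.1] at h4
  intro h0
  have hlim : Tendsto (fun x => |ψ.eval x|) (𝓝[<] η) (𝓝 |ψ.eval η|) :=
    (ψ.continuous.abs.tendsto η).mono_left nhdsWithin_le_nhds
  have := ge_of_tendsto hlim (Filter.mem_of_superset (Ioo_mem_nhdsLT hη.1) hbound)
  rw [h0, abs_zero] at this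
  linarith [hη.1]

theorem radius_lt_norm_of_eval_eq_zero {k : ℕ} (hk : 1 ≤ k) {η : ℝ} {ψ : ℝ[X]}
    (hη : η ∈ Set.Ioo 0 (radius k)) (hη0 : (Delta k).eval η = 0)
    (hψ : Delta k = (1 - C η⁻¹ * X) * ψ) {ζ : ℂ} (hζ : aeval ζ ψ = 0) : radius k < ‖ζ‖ := by
  by_contra! hle
  have h1 : aeval ζ (Delta k) = 0 := by rw [hψ, map_mul, hζ, mul_zero]
  have h2 : ζ = η := eq_of_aeval_Delta_eq_zero hk hle (norm_ofReal_le_radius hη) h1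
    (by rw [aeval_ofReal_Delta, hη0, Complex.ofReal_zero])
  rw [h2, ← Complex.coe_algebraMap, aeval_algebraMap_apply, coe_aeval_eq_eval,
    Complex.coe_algebraMap, Complex.ofReal_eq_zero] at hζ
  exact eval_ne_zero_of_Delta_eq hk hη hη0 hψ hζ

theorem exists_Delta_eq {k : ℕ} {η : ℝ} (hη : η ≠ 0) (hη0 : (Delta k).eval η = 0) :
    ∃ ψ : ℝ[X], Delta k = (1 - C η⁻¹ * X) * ψ := by
  obtain ⟨q, hq⟩ := dvd_iff_isRoot.mpr hη0
  refine ⟨C (-η) * q, ?_⟩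
  have h1 : C η⁻¹ * C η = (1 : ℝ[X]) := by rw [← C_mul, inv_mul_cancel₀ hη, C_1]
  rw [hq, C_neg]
  linear_combination (-X * q) * h1

/-- The subtracted product is at most `C_k η^(2k-1) ≤ r ≤ 1/4`, since its other factor is at most
`1`. -/
theorem eval_g_pos {k : ℕ} (hk : 1 ≤ k) {η : ℝ} (hη : η ∈ Set.Ioo 0 (radius k)) :
    0 < (g k).eval η := by
  have hr4 : radius k ≤ 1 / 4 := radius_le hk
  have hη1 := hη.1
  have h1 : (g k).eval η = 2 - c k * η ^ (2 * k - 1) * (1 - η - 2 * (c k * η ^ (2 * k + 1))) := by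
    simp only [g, h, eval_sub, eval_mul, eval_pow, eval_X, eval_one, eval_natCast, eval_ofNat]
    ring
  have h2 : c k * η ^ (2 * k - 1) ≤ radius k := by
    have h3 : c k * radius k ^ (2 * k - 1) ≤ radius k := by
      refine le_of_mul_le_mul_right ?_ (radius_pos k)
      calc c k * radius k ^ (2 * k - 1) * radius k = c k * radius k ^ (2 * k) := by
            rw [mul_assoc, ← pow_succ]
            congr 2
            omega
        _ ≤ radius k ^ 2 := c_mul_radius_pow_le hk
        _ = radius k * radius k := sq _
    refine le_trans ?_ h3
    have := hη.2.le
    gcongr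
  have h3 : 0 ≤ c k * η ^ (2 * k - 1) := by positivity
  have h4 : 0 ≤ c k * η ^ (2 * k + 1) := by positivity
  rw [h1]
  nlinarith

/-! ### The power series of `(1 - xz)^(-1/2)` -/

/-- The coefficients of `(1 - z)^(-1/2)`. -/
noncomputable def invSqrtCoeff (n : ℕ) : ℝ := n.centralBinom / 4 ^ n

theorem invSqrtCoeff_pos (n : ℕ) : 0 < invSqrtCoeff n := by
  have := n.centralBinom_pos
  unfold invSqrtCoeff
  positivity

theorem invSqrtCoeff_zero : invSqrtCoeff 0 = 1 := by simp [invSqrtCoeff]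

theorem invSqrtCoeff_le_one (n : ℕ) : invSqrtCoeff n ≤ 1 := by
  rw [invSqrtCoeff, div_le_one (by positivity)]
  exact_mod_cast n.centralBinom_le_four_pow

theorem invSqrtCoeff_succ (n : ℕ) :
    (2 * n + 2) * invSqrtCoeff (n + 1) = (2 * n + 1) * invSqrtCoeff n := by
  have h : ((n : ℝ) + 1) * (n + 1).centralBinom = 2 * (2 * n + 1) * n.centralBinom := by
    exact_mod_cast n.succ_mul_centralBinom_succ
  rw [invSqrtCoeff, invSqrtCoeff, pow_succ]
  field_simp
  linear_combination 2 * h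

/-- The ratio `a_(n+1)/a_n = (2n+1)/(2n+2)` increases with `n`. The consequence `a_(n-j)/a_n ≤
1/a_j` is the domination, uniform in `n`, used for Tannery's theorem. -/
theorem invSqrtCoeff_mul_le (m n : ℕ) :
    invSqrtCoeff m * invSqrtCoeff n ≤ invSqrtCoeff (m + n) := by
  induction n with
  | zero => simp [invSqrtCoeff_zero]
  | succ n ih =>
    have h1 : invSqrtCoeff (n + 1) = (2 * n + 1) / (2 * n + 2) * invSqrtCoeff n := by
      have := invSqrtCoeff_succ n
      field_simp
      linarith
    have h2 : invSqrtCoeff (m + (n + 1)) =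
        (2 * (m + n) + 1) / (2 * (m + n) + 2) * invSqrtCoeff (m + n) := by
      have := invSqrtCoeff_succ (m + n)
      rw [← add_assoc]
      push_cast at this
      field_simp
      linarith
    rw [h1, h2]
    calc invSqrtCoeff m * ((2 * n + 1) / (2 * n + 2) * invSqrtCoeff n)
        = (2 * n + 1) / (2 * n + 2) * (invSqrtCoeff m * invSqrtCoeff n) := by ring
      _ ≤ (2 * (m + n) + 1) / (2 * (m + n) + 2) * invSqrtCoeff (m + n) := by
        have := invSqrtCoeff_pos m
        have := invSqrtCoeff_pos n
        gcongr ?_ * ?_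
        rw [div_le_div_iff₀ (by positivity) (by positivity)]
        nlinarith [(Nat.cast_nonneg m : (0 : ℝ) ≤ m)]

theorem one_le_mul_invSqrtCoeff (n : ℕ) : 1 ≤ (2 * n + 1) * invSqrtCoeff n := by
  rcases Nat.eq_zero_or_pos n with rfl | hn
  · simp [invSqrtCoeff_zero]
  · have h : (4 : ℝ) ^ n ≤ 2 * n * n.centralBinom := by
      exact_mod_cast n.four_pow_le_two_mul_self_mul_centralBinom hn
    rw [invSqrtCoeff, mul_div_assoc', one_le_div (by positivity)]
    nlinarith [(Nat.cast_nonneg n.centralBinom : (0 : ℝ) ≤ n.centralBinom)]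

theorem tendsto_invSqrtCoeff_div_add (j : ℕ) :
    Tendsto (fun n => invSqrtCoeff n / invSqrtCoeff (n + j)) atTop (𝓝 1) := by
  induction j with
  | zero =>
    refine tendsto_const_nhds.congr fun n => ?_
    rw [add_zero, div_self (invSqrtCoeff_pos n).ne']
  | succ j ih =>
    have h1 : Tendsto (fun n : ℕ => 1 + 1 / (2 * ((n + j : ℕ) : ℝ) + 1)) atTop (𝓝 (1 + 0)) := by
      refine tendsto_const_nhds.add (tendsto_const_nhds.div_atTop ?_)
      refine tendsto_atTop_add_const_right _ _ (Tendsto.const_mul_atTop two_pos ?_)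
      exact tendsto_natCast_atTop_atTop.comp (tendsto_add_atTop_nat j)
    have h2 := ih.mul h1
    rw [add_zero, mul_one] at h2
    refine h2.congr fun n => ?_
    have h3 := invSqrtCoeff_succ (n + j)
    have h4 := (invSqrtCoeff_pos (n + j)).ne'
    have h5 := (invSqrtCoeff_pos (n + j + 1)).ne'
    rw [← add_assoc]
    have h6 : 2 * ((n + j : ℕ) : ℝ) + 1 ≠ 0 := by positivity
    field_simp
    linear_combination invSqrtCoeff n * h3

/-- The power series of `(1 - xz)^(-1/2)`. -/
noncomputable def invSqrt (x : ℂ) : PowerSeries ℂ :=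
  PowerSeries.mk fun n => (invSqrtCoeff n : ℂ) * x ^ n

theorem constantCoeff_invSqrt (x : ℂ) : PowerSeries.constantCoeff (invSqrt x) = 1 := by
  rw [← PowerSeries.coeff_zero_eq_constantCoeff_apply, invSqrt, PowerSeries.coeff_mk,
    invSqrtCoeff_zero]
  simp

/-- The recurrence for the coefficients is the differential equation `2(1 - xz)f' = xf`, which makes
the derivative of `f²(1 - xz)` vanish. -/
theorem invSqrt_sq_mul (x : ℂ) :
    invSqrt x ^ 2 * (1 - PowerSeries.C x * PowerSeries.X) = 1 := by
  have key : 2 * (1 - PowerSeries.C x * PowerSeries.X) * PowerSeries.derivative ℂ (invSqrt x) =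
      PowerSeries.C x * invSqrt x := by
    rw [show 2 * (1 - PowerSeries.C x * PowerSeries.X) * PowerSeries.derivative ℂ (invSqrt x) =
      PowerSeries.C 2 * PowerSeries.derivative ℂ (invSqrt x)
      - PowerSeries.C (2 * x) * (PowerSeries.X * PowerSeries.derivative ℂ (invSqrt x)) by
        rw [map_mul, map_ofNat]; ring]
    ext n
    have h : (2 * (n : ℂ) + 2) * invSqrtCoeff (n + 1) = (2 * n + 1) * invSqrtCoeff n := by
      exact_mod_cast congrArg ((↑) : ℝ → ℂ) (invSqrtCoeff_succ n)
    cases n with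
    | zero =>
      rw [map_sub, PowerSeries.coeff_C_mul, PowerSeries.coeff_C_mul, PowerSeries.coeff_C_mul,
        PowerSeries.coeff_zero_X_mul, PowerSeries.coeff_derivative]
      simp only [invSqrt, PowerSeries.coeff_mk]
      push_cast at h ⊢
      linear_combination x * h
    | succ n =>
      rw [map_sub, PowerSeries.coeff_C_mul, PowerSeries.coeff_C_mul, PowerSeries.coeff_C_mul,
        PowerSeries.coeff_succ_X_mul, PowerSeries.coeff_derivative, PowerSeries.coeff_derivative]
      simp only [invSqrt, PowerSeries.coeff_mk]
      push_cast at h ⊢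
      linear_combination x ^ (n + 2) * h
  refine PowerSeries.derivative.ext ?_ ?_
  · simp only [Derivation.leibniz, Derivation.leibniz_pow, map_sub, smul_eq_mul, nsmul_eq_mul,
      PowerSeries.derivative_X, PowerSeries.derivative_C, Derivation.map_one_eq_zero]
    push_cast
    linear_combination invSqrt x * key
  · simp [constantCoeff_invSqrt]

/-! ### Power series converging absolutely on a closed disc -/

/-- The power series `f` converges absolutely on the closed disc of radius `r`. -/
def AbsConv (r : ℝ) (f : PowerSeries ℂ) : Prop :=
  Summable fun n => ‖PowerSeries.coeff n f * (r : ℂ) ^ n‖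

/-- The value at `x` of a power series. -/
noncomputable def value (x : ℂ) (f : PowerSeries ℂ) : ℂ := ∑' n, PowerSeries.coeff n f * x ^ n

theorem coeff_mul_mul_pow (f g : PowerSeries ℂ) (x : ℂ) (n : ℕ) :
    PowerSeries.coeff n (f * g) * x ^ n = ∑ ij ∈ Finset.HasAntidiagonal.antidiagonal n,
      (PowerSeries.coeff ij.1 f * x ^ ij.1) * (PowerSeries.coeff ij.2 g * x ^ ij.2) := by
  rw [PowerSeries.coeff_mul, Finset.sum_mul]
  refine Finset.sum_congr rfl fun ij hij => ?_
  rw [← Finset.HasAntidiagonal.mem_antidiagonal.mp hij, pow_add]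
  ring

theorem AbsConv.mul {r : ℝ} {f g : PowerSeries ℂ} (hf : AbsConv r f) (hg : AbsConv r g) :
    AbsConv r (f * g) := by
  have h := summable_norm_sum_mul_antidiagonal_of_summable_norm hf hg
  exact h.congr fun n => by rw [coeff_mul_mul_pow]

theorem AbsConv.value_mul {r : ℝ} {f g : PowerSeries ℂ} (hf : AbsConv r f) (hg : AbsConv r g) :
    value r (f * g) = value r f * value r g := by
  rw [value, value, value, tsum_mul_tsum_eq_tsum_sum_antidiagonal_of_summable_norm hf hg]
  exact tsum_congr fun n => coeff_mul_mul_pow f g r n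

theorem AbsConv.mono {r t : ℝ} {f : PowerSeries ℂ} (hf : AbsConv r f) (ht : 0 ≤ t) (htr : t ≤ r) :
    AbsConv t f := by
  refine Summable.of_nonneg_of_le (fun n => norm_nonneg _) (fun n => ?_) hf
  rw [norm_mul, norm_mul, norm_pow, norm_pow, Complex.norm_real, Complex.norm_real,
    Real.norm_of_nonneg ht, Real.norm_of_nonneg (ht.trans htr)]
  gcongr

theorem absConv_coe (r : ℝ) (P : ℂ[X]) : AbsConv r P := by
  refine summable_of_ne_finset_zero (s := Finset.range (P.natDegree + 1)) fun n hn => ?_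
  rw [Polynomial.coeff_coe, coeff_eq_zero_of_natDegree_lt (by simpa using hn), zero_mul, norm_zero]

theorem value_coe (x : ℂ) (P : ℂ[X]) : value x P = P.eval x := by
  rw [value, eval_eq_sum_range, tsum_eq_sum (s := Finset.range (P.natDegree + 1))]
  · simp
  · intro n hn
    rw [Polynomial.coeff_coe, coeff_eq_zero_of_natDegree_lt (by simpa using hn), zero_mul]

theorem absConv_invSqrt {r : ℝ} (hr : 0 ≤ r) {ζ : ℂ} (hζ : r < ‖ζ‖) :
    AbsConv r (invSqrt ζ⁻¹) := by
  have h0 : 0 < ‖ζ‖ := hr.trans_lt hζ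
  refine Summable.of_nonneg_of_le (fun n => norm_nonneg _) (fun n => ?_)
    (summable_geometric_of_lt_one (div_nonneg hr h0.le) ((div_lt_one h0).mpr hζ))
  rw [invSqrt, PowerSeries.coeff_mk, norm_mul, norm_mul, norm_pow, norm_pow, Complex.norm_real,
    Complex.norm_real, Real.norm_of_nonneg hr, Real.norm_of_nonneg (invSqrtCoeff_pos n).le,
    norm_inv, div_eq_inv_mul, mul_pow, mul_assoc]
  exact mul_le_of_le_one_left (by positivity) (invSqrtCoeff_le_one n)

/-- `P` is the product of the factors `1 - z/ζ` over its roots, and each factor has an inverse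
square root converging absolutely up to `r < |ζ|`. -/
theorem exists_invSqrt_of_roots {r : ℝ} (hr : 0 ≤ r) (d : ℕ) (P : ℂ[X]) (hd : P.natDegree = d)
    (h1 : P.coeff 0 = 1) (hP : ∀ ζ, P.eval ζ = 0 → r < ‖ζ‖) :
    ∃ B : PowerSeries ℂ, AbsConv r B ∧ B ^ 2 * P = 1 ∧ PowerSeries.constantCoeff B = 1 := by
  induction d generalizing P with
  | zero =>
    refine ⟨((1 : ℂ[X]) : PowerSeries ℂ), absConv_coe r 1, ?_, by simp⟩
    rw [eq_C_of_natDegree_eq_zero hd, h1]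
    simp
  | succ d ih =>
    obtain ⟨ζ, hζ⟩ := IsAlgClosed.exists_root P
      (fun h => by rw [natDegree_eq_of_degree_eq_some h] at hd; simp at hd)
    have hζ0 : ζ ≠ 0 := norm_pos_iff.mp (hr.trans_lt (hP ζ hζ))
    obtain ⟨Q, hQ⟩ := dvd_iff_isRoot.mpr hζ
    have hfac : P = (1 - C ζ⁻¹ * X) * (C (-ζ) * Q) := by
      have h1 : C ζ⁻¹ * C ζ = (1 : ℂ[X]) := by rw [← C_mul, inv_mul_cancel₀ hζ0, C_1]
      rw [hQ, C_neg]
      linear_combination (-X * Q) * h1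
    have hdeg : (C (-ζ) * Q).natDegree = d := by
      have hQ0 : Q ≠ 0 := by rintro rfl; simp [hQ] at h1
      rw [hQ, natDegree_mul (X_sub_C_ne_zero ζ) hQ0, natDegree_X_sub_C] at hd
      rw [natDegree_C_mul (neg_ne_zero.mpr hζ0)]
      omega
    obtain ⟨B, hB, hB2, hB0⟩ := ih (C (-ζ) * Q) hdeg
      (by rw [hfac, mul_coeff_zero] at h1; simpa using h1)
      (fun ξ hξ => hP ξ (by rw [hfac, eval_mul, hξ, mul_zero]))
    refine ⟨invSqrt ζ⁻¹ * B, (absConv_invSqrt hr (hP ζ hζ)).mul hB, ?_, ?_⟩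
    · have h2 := invSqrt_sq_mul ζ⁻¹
      rw [hfac, Polynomial.coe_mul]
      simp only [Polynomial.coe_sub, Polynomial.coe_one, Polynomial.coe_mul, Polynomial.coe_C,
        Polynomial.coe_X] at hB2 ⊢
      calc _ = (invSqrt ζ⁻¹ ^ 2 * (1 - PowerSeries.C ζ⁻¹ * PowerSeries.X))
            * (B ^ 2 * (PowerSeries.C (-ζ) * (Q : PowerSeries ℂ))) := by ring
        _ = 1 := by rw [h2, hB2, one_mul]
    · rw [map_mul, constantCoeff_invSqrt, hB0, one_mul]

/-- `1/a_n ≤ 2n + 1` is absorbed by the geometric gain `(t/r)ⁿ`. This is the summable majorant for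
`tendsto_coeff_invSqrt_mul`. -/
theorem AbsConv.summable_div_invSqrtCoeff {r t : ℝ} {f : PowerSeries ℂ} (hf : AbsConv r f)
    (ht : 0 < t) (htr : t < r) :
    Summable fun n => ‖PowerSeries.coeff n f * (t : ℂ) ^ n‖ / invSqrtCoeff n := by
  have hr := ht.trans htr
  have hlim : Tendsto (fun n : ℕ => (2 * (n : ℝ) + 1) * (t / r) ^ n) atTop (𝓝 0) := by
    have hq : |t / r| < 1 := by
      rw [abs_of_pos (div_pos ht hr)]
      exact (div_lt_one hr).mpr htr
    have h := ((tendsto_self_mul_const_pow_of_abs_lt_one hq).const_mul 2).add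
      (tendsto_pow_atTop_nhds_zero_of_abs_lt_one hq)
    rw [mul_zero, add_zero] at h
    exact h.congr fun n => by ring
  refine summable_of_isBigO_nat hf (Asymptotics.IsBigO.of_bound 1 ?_)
  filter_upwards [hlim.eventually_le_const one_pos] with n hn
  rw [norm_norm, one_mul, Real.norm_of_nonneg (div_nonneg (norm_nonneg _) (invSqrtCoeff_pos n).le),
    div_le_iff₀ (invSqrtCoeff_pos n), norm_mul, norm_mul, norm_pow, norm_pow, Complex.norm_real,
    Complex.norm_real, Real.norm_of_nonneg ht.le, Real.norm_of_nonneg hr.le, mul_assoc]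
  gcongr
  have h1 := one_le_mul_invSqrtCoeff n
  have h2 : t ^ n = (t / r) ^ n * r ^ n := by rw [← mul_pow, div_mul_cancel₀ _ hr.ne']
  rw [h2]
  have h3 : (t / r) ^ n ≤ invSqrtCoeff n := by
    have h4 := invSqrtCoeff_pos n
    have h5 : 0 < (t / r) ^ n := by positivity
    nlinarith
  rw [mul_comm]
  gcongr

/-- The normalised coefficient is the sum over `j ≤ n` of `(a_(n-j)/a_n) f_j t^j`. Each quotient
tends to `1`, and dominated convergence allows the limit inside the sum. -/
theorem tendsto_coeff_invSqrt_mul {r t : ℝ} {f : PowerSeries ℂ} (hf : AbsConv r f) (ht : 0 < t)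
    (htr : t < r) :
    Tendsto (fun n => PowerSeries.coeff n (invSqrt (t : ℂ)⁻¹ * f) * (t : ℂ) ^ n / invSqrtCoeff n)
      atTop (𝓝 (value t f)) := by
  have htC : (t : ℂ) ≠ 0 := by exact_mod_cast ht.ne'
  let F (n j : ℕ) : ℂ := if j ≤ n then
    ((invSqrtCoeff (n - j) / invSqrtCoeff n : ℝ) : ℂ) * (PowerSeries.coeff j f * (t : ℂ) ^ j) else 0
  have hF (n : ℕ) : PowerSeries.coeff n (invSqrt (t : ℂ)⁻¹ * f) * (t : ℂ) ^ n / invSqrtCoeff n =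
      ∑' j, F n j := by
    rw [tsum_eq_sum (s := Finset.range (n + 1))]
    · rw [coeff_mul_mul_pow, Finset.Nat.sum_antidiagonal_eq_sum_range_succ_mk,
        ← Finset.sum_range_reflect, Finset.sum_div]
      refine Finset.sum_congr rfl fun j hj => ?_
      have hj : j ≤ n := by simpa [Nat.lt_succ_iff] using hj
      rw [show n + 1 - 1 - j = n - j by omega, show n - (n - j) = j by omega]
      simp only [F, if_pos hj, invSqrt, PowerSeries.coeff_mk]
      rw [mul_assoc (invSqrtCoeff (n - j) : ℂ), ← mul_pow, inv_mul_cancel₀ htC, one_pow]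
      push_cast
      ring
    · intro j hj
      exact if_neg (by simpa using hj)
  simp_rw [hF]
  refine tendsto_tsum_of_dominated_convergence (hf.summable_div_invSqrtCoeff ht htr) ?_ ?_
  · intro j
    have h1 := (tendsto_invSqrtCoeff_div_add j).comp (tendsto_sub_atTop_nat j)
    have h2 := ((Complex.continuous_ofReal.tendsto _).comp h1).mul_const
      (PowerSeries.coeff j f * (t : ℂ) ^ j)
    rw [Complex.ofReal_one, one_mul] at h2
    refine h2.congr' ?_
    filter_upwards [eventually_ge_atTop j] with n hn
    simp only [F, if_pos hn, Function.comp, Nat.sub_add_cancel hn]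
  · refine Eventually.of_forall fun n j => ?_
    have hj := invSqrtCoeff_pos j
    have hn := invSqrtCoeff_pos n
    by_cases h : j ≤ n
    · simp only [F, if_pos h]
      rw [norm_mul, Complex.norm_real,
        Real.norm_of_nonneg (div_nonneg (invSqrtCoeff_pos _).le hn.le), div_eq_inv_mul _ (invSqrtCoeff j)]
      gcongr
      rw [div_le_iff₀ hn, inv_mul_eq_div, le_div_iff₀ hj]
      simpa [Nat.sub_add_cancel h] using invSqrtCoeff_mul_le (n - j) j
    · simp only [F, if_neg h, norm_zero]
      positivity

/-! ### Asymptotics of the coefficients -/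

/-- The square root of `Δ_k`. -/
noncomputable def sqrtDelta (k : ℕ) : PowerSeries ℝ :=
  1 - PowerSeries.X + 2 * PowerSeries.X * sigmaSeries k - 4 * PowerSeries.X * R k

/-- The right-hand side is the discriminant of the quadratic equation for `R`. -/
theorem coe_Delta (k : ℕ) : (Delta k : PowerSeries ℝ) =
    (1 - PowerSeries.X + 2 * PowerSeries.X * sigmaSeries k) ^ 2
      - 8 * PowerSeries.X ^ 2 * (1 + PowerSeries.C (k : ℝ) + sigmaSeries k ^ 2) := by
  rw [Delta, p, h, sigmaSeries, map_natCast, map_natCast]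
  have h1 (n : ℕ) : ((n : ℝ[X]) : PowerSeries ℝ) = n :=
    map_natCast (Polynomial.coeToPowerSeries.ringHom (R := ℝ)) n
  have h2 (n : ℕ) [n.AtLeastTwo] : ((ofNat(n) : ℝ[X]) : PowerSeries ℝ) = ofNat(n) :=
    map_ofNat (Polynomial.coeToPowerSeries.ringHom (R := ℝ)) n
  simp only [Polynomial.coe_add, Polynomial.coe_sub, Polynomial.coe_mul, Polynomial.coe_pow,
    Polynomial.coe_one, Polynomial.coe_X, h1, h2]
  ring

theorem coe_X_mul_g {k : ℕ} (hk : 1 ≤ k) : ((X * g k : ℝ[X]) : PowerSeries ℝ) =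
    2 * PowerSeries.X
      - sigmaSeries k * (1 - PowerSeries.X - 2 * PowerSeries.X * sigmaSeries k) := by
  have h0 : X * g k = 2 * X - (c k : ℝ[X]) * X ^ (2 * k)
      * (h k - (c k : ℝ[X]) * X ^ (2 * k + 1)) := by
    rw [g, show X ^ (2 * k) = X * X ^ (2 * k - 1) by rw [← pow_succ']; congr 1; omega]
    ring
  rw [h0, h, sigmaSeries, map_natCast]
  have h1 (n : ℕ) : ((n : ℝ[X]) : PowerSeries ℝ) = n :=
    map_natCast (Polynomial.coeToPowerSeries.ringHom (R := ℝ)) n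
  have h2 (n : ℕ) [n.AtLeastTwo] : ((ofNat(n) : ℝ[X]) : PowerSeries ℝ) = ofNat(n) :=
    map_ofNat (Polynomial.coeToPowerSeries.ringHom (R := ℝ)) n
  simp only [Polynomial.coe_sub, Polynomial.coe_mul, Polynomial.coe_pow,
    Polynomial.coe_one, Polynomial.coe_X, h1, h2]
  ring

theorem sqrtDelta_sq {k : ℕ} (hk : 1 ≤ k) : sqrtDelta k ^ 2 = Delta k := by
  rw [coe_Delta, sqrtDelta]
  linear_combination (-8 * PowerSeries.X) * R_eq hk

theorem constantCoeff_sqrtDelta (k : ℕ) : PowerSeries.constantCoeff (sqrtDelta k) = 1 := by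
  simp [sqrtDelta]

theorem two_mul_L_mul_sqrtDelta {k : ℕ} (hk : 1 ≤ k) :
    2 * L k * sqrtDelta k = PowerSeries.C (k : ℝ) * (X * g k : ℝ[X])
      + PowerSeries.C (k : ℝ) * sigmaSeries k * sqrtDelta k := by
  rw [coe_X_mul_g hk, sqrtDelta]
  linear_combination 2 * L_eq hk

/-- Differentiation supplies the factor `n` of the denominator and replaces `Δ_k^(1/2)` by a
polynomial times `Δ_k^(-1/2)`, the same singularity as that of `L`. -/
theorem two_mul_sqrtDelta_mul_derivative {k : ℕ} (hk : 1 ≤ k) :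
    2 * sqrtDelta k * PowerSeries.derivative ℝ (sqrtDelta k) =
      (derivative (Delta k) : ℝ[X]) := by
  rw [← PowerSeries.derivative_coe, ← sqrtDelta_sq hk, PowerSeries.derivative_pow]
  simp

/-- The inclusion of the real power series in the complex ones. -/
noncomputable abbrev toComplex : PowerSeries ℝ →+* PowerSeries ℂ :=
  PowerSeries.map (algebraMap ℝ ℂ)

theorem toComplex_coe (P : ℝ[X]) :
    toComplex P = ((P.map (algebraMap ℝ ℂ) : ℂ[X]) : PowerSeries ℂ) :=
  (Polynomial.polynomial_map_coe).symm

theorem coeff_zero_Delta (k : ℕ) : (Delta k).coeff 0 = 1 := by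
  rw [coeff_zero_eq_eval_zero, eval_Delta]
  simp

theorem exists_inverse_sqrtDelta {k : ℕ} (hk : 1 ≤ k) {η : ℝ} {ψ : ℝ[X]}
    (hη : η ∈ Set.Ioo 0 (radius k)) (hη0 : (Delta k).eval η = 0)
    (hψ : Delta k = (1 - C η⁻¹ * X) * ψ) :
    ∃ B : PowerSeries ℂ, AbsConv (radius k) B ∧ value η B ≠ 0 ∧
      toComplex (sqrtDelta k) * (invSqrt (η : ℂ)⁻¹ * B) = 1 := by
  have hr := radius_pos k
  obtain ⟨B, hB, hB2, hB0⟩ := exists_invSqrt_of_roots hr.le _ (ψ.map (algebraMap ℝ ℂ)) rfl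
    (by
      have h1 := coeff_zero_Delta k
      rw [hψ, mul_coeff_zero] at h1
      have h2 : ψ.coeff 0 = 1 := by simpa using h1
      rw [coeff_map, h2, map_one])
    (fun ζ hζ => radius_lt_norm_of_eval_eq_zero hk hη hη0 hψ (by rwa [eval_map_algebraMap] at hζ))
  refine ⟨B, hB, fun h0 => ?_, ?_⟩
  · have h1 := hB.mono hη.1.le hη.2.le
    have h2 := congrArg (value η) hB2
    rw [sq, (h1.mul h1).value_mul (absConv_coe η _), h1.value_mul h1, h0, zero_mul, zero_mul,
      ← Polynomial.coe_one, value_coe, eval_one] at h2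
    exact zero_ne_one h2
  · set D := toComplex (sqrtDelta k) with hD
    have hD2 : D ^ 2 = (1 - PowerSeries.C (η : ℂ)⁻¹ * PowerSeries.X)
        * ((ψ.map (algebraMap ℝ ℂ) : ℂ[X]) : PowerSeries ℂ) := by
      rw [hD, ← map_pow, sqrtDelta_sq hk, toComplex_coe, hψ]
      simp
    have h1 : (D * (invSqrt (η : ℂ)⁻¹ * B)) ^ 2 = 1 := by
      calc _ = D ^ 2 * invSqrt (η : ℂ)⁻¹ ^ 2 * B ^ 2 := by ring
        _ = (invSqrt (η : ℂ)⁻¹ ^ 2 * (1 - PowerSeries.C (η : ℂ)⁻¹ * PowerSeries.X))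
            * (B ^ 2 * ((ψ.map (algebraMap ℝ ℂ) : ℂ[X]) : PowerSeries ℂ)) := by rw [hD2]; ring
        _ = 1 := by rw [invSqrt_sq_mul, hB2, one_mul]
    -- The constant coefficient, which is `1` for all three factors, selects the sign of the square
    -- root.
    refine (eq_or_eq_neg_of_sq_eq_sq _ 1 (by rw [h1, one_pow])).resolve_right ?_
    intro h2
    have h3 := congrArg PowerSeries.constantCoeff h2
    rw [map_mul, map_mul, constantCoeff_invSqrt, hB0, hD,
      ← PowerSeries.coeff_zero_eq_constantCoeff_apply, PowerSeries.coeff_map,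
      PowerSeries.coeff_zero_eq_constantCoeff_apply, constantCoeff_sqrtDelta, map_neg, map_one,
      map_one] at h3
    norm_num at h3

theorem tendsto_letters_ratio {k : ℕ} (hk : 1 ≤ k) {η : ℝ} {ψ : ℝ[X]}
    (hη : η ∈ Set.Ioo 0 (radius k)) (hη0 : (Delta k).eval η = 0)
    (hψ : Delta k = (1 - C η⁻¹ * X) * ψ) :
    Tendsto (fun n : ℕ => PowerSeries.coeff n (L k) / (n * PowerSeries.coeff n (R k)))
      atTop (𝓝 (4 * k * η ^ 2 * (g k).eval η / ψ.eval η)) := by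
  obtain ⟨B, hB, hBη, hinv⟩ := exists_inverse_sqrtDelta hk hη hη0 hψ
  have hηC : (η : ℂ) ≠ 0 := by exact_mod_cast hη.1.ne'
  have hψ0 := eval_ne_zero_of_Delta_eq hk hη hη0 hψ
  set A := invSqrt (η : ℂ)⁻¹ with hA
  let G : ℂ[X] := (X * g k).map (algebraMap ℝ ℂ)
  let Q : ℂ[X] := (derivative (Delta k)).map (algebraMap ℝ ℂ)
  have hlim (P : ℂ[X]) : Tendsto
      (fun n => PowerSeries.coeff n (A * ((P : PowerSeries ℂ) * B)) * (η : ℂ) ^ n / invSqrtCoeff n) atTop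
      (𝓝 (P.eval (η : ℂ) * value η B)) := by
    have h1 := tendsto_coeff_invSqrt_mul ((absConv_coe _ P).mul hB) hη.1 hη.2
    rwa [((absConv_coe _ P).mono hη.1.le hη.2.le).value_mul (hB.mono hη.1.le hη.2.le),
      value_coe] at h1
  have hL : 2 * toComplex (L k) = PowerSeries.C (k : ℂ) * (A * ((G : PowerSeries ℂ) * B))
      + PowerSeries.C (k : ℂ) * toComplex (sigmaSeries k) := by
    have h1 := congrArg toComplex (two_mul_L_mul_sqrtDelta hk)
    simp only [map_mul, map_add, toComplex_coe, map_ofNat, map_natCast] at h1 ⊢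
    linear_combination (A * B) * h1
      + (k * toComplex (sigmaSeries k) - 2 * toComplex (L k)) * hinv
  have hD : 2 * toComplex (PowerSeries.derivative ℝ (sqrtDelta k)) = A * ((Q : PowerSeries ℂ) * B) := by
    have h1 := congrArg toComplex (two_mul_sqrtDelta_mul_derivative hk)
    simp only [map_mul, toComplex_coe, map_ofNat] at h1
    linear_combination (A * B) * h1
      - 2 * toComplex (PowerSeries.derivative ℝ (sqrtDelta k)) * hinv
  have hcoefS {n : ℕ} (hn : 2 * k < n) : PowerSeries.coeff n (sigmaSeries k) = 0 := by
    rw [sigmaSeries, PowerSeries.coeff_C_mul, PowerSeries.coeff_X_pow, if_neg hn.ne', mul_zero]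
  have hcoefL {n : ℕ} (hn : 2 * k < n) :
      ((PowerSeries.coeff n (L k) : ℝ) : ℂ) = k / 2 * PowerSeries.coeff n (A * ((G : PowerSeries ℂ) * B)) := by
    have h1 := congrArg (PowerSeries.coeff n) hL
    rw [show (2 : PowerSeries ℂ) = PowerSeries.C 2 from (map_ofNat _ 2).symm, map_add,
      PowerSeries.coeff_C_mul, PowerSeries.coeff_C_mul, PowerSeries.coeff_C_mul,
      PowerSeries.coeff_map, PowerSeries.coeff_map, hcoefS hn, map_zero,
      Complex.coe_algebraMap] at h1
    linear_combination h1 / 2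
  -- The `n`-th coefficient of `D'` is `(n+1)[z^(n+1)]D`, and `[z^(n+1)]D = -4[zⁿ]R` once `n`
  -- exceeds the degree `2k` of `S`.
  have hcoefR {n : ℕ} (hn : 2 * k < n) :
      ((n + 1 : ℕ) : ℂ) * ((PowerSeries.coeff n (R k) : ℝ) : ℂ) =
        -(1 / 8) * PowerSeries.coeff n (A * ((Q : PowerSeries ℂ) * B)) := by
    have h0 : PowerSeries.coeff (n + 1) (sqrtDelta k) = -4 * PowerSeries.coeff n (R k) := by
      rw [sqrtDelta, show 1 - PowerSeries.X + 2 * PowerSeries.X * sigmaSeries k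
        - 4 * PowerSeries.X * R k = 1 - PowerSeries.X
          + PowerSeries.X * (PowerSeries.C 2 * sigmaSeries k - PowerSeries.C 4 * R k) by
          rw [map_ofNat, map_ofNat]; ring, map_add, map_sub, PowerSeries.coeff_succ_X_mul, map_sub,
        PowerSeries.coeff_C_mul, PowerSeries.coeff_C_mul, hcoefS hn, PowerSeries.coeff_one,
        PowerSeries.coeff_X, if_neg (by omega), if_neg (by omega)]
      ring
    have h1 := congrArg (PowerSeries.coeff n) hD
    rw [show (2 : PowerSeries ℂ) = PowerSeries.C 2 from (map_ofNat _ 2).symm,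
      PowerSeries.coeff_C_mul, PowerSeries.coeff_map, PowerSeries.coeff_derivative, h0,
      Complex.coe_algebraMap] at h1
    push_cast at h1 ⊢
    linear_combination -h1 / 8
  have hG : G.eval (η : ℂ) = ((η * (g k).eval η : ℝ) : ℂ) := by
    rw [eval_map_algebraMap, ← Complex.coe_algebraMap, aeval_algebraMap_apply, coe_aeval_eq_eval,
      eval_mul, eval_X]
  have hQ : Q.eval (η : ℂ) = ((-(ψ.eval η / η) : ℝ) : ℂ) := by
    have h1 : (derivative (Delta k)).eval η = -(ψ.eval η / η) := by
      rw [hψ]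
      simp [inv_mul_cancel₀ hη.1.ne']
      ring
    rw [eval_map_algebraMap, ← Complex.coe_algebraMap, aeval_algebraMap_apply, coe_aeval_eq_eval,
      h1]
  have hQ0 : Q.eval (η : ℂ) ≠ 0 := by
    rw [hQ, Complex.ofReal_ne_zero]
    exact neg_ne_zero.mpr (div_ne_zero hψ0 hη.1.ne')
  have hquot := ((hlim G).div (hlim Q) (mul_ne_zero hQ0 hBη)).const_mul (-4 * k : ℂ)
  -- This is `(n+1)/n`: the derivative produces `(n+1)[zⁿ]R`, while the ratio has `n[zⁿ]R`.
  have hn1 : Tendsto (fun n : ℕ => 1 + 1 / (n : ℂ)) atTop (𝓝 (1 + 0)) :=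
    tendsto_const_nhds.add tendsto_one_div_atTop_nhds_zero_nat
  have hfin := hn1.mul hquot
  rw [← tendsto_ofReal_iff]
  have hval : (1 + 0) * (-4 * (k : ℂ) * (G.eval (η : ℂ) * value η B / (Q.eval (η : ℂ) * value η B)))
      = ((4 * k * η ^ 2 * (g k).eval η / ψ.eval η : ℝ) : ℂ) := by
    have hψC : ((ψ.eval η : ℝ) : ℂ) ≠ 0 := by exact_mod_cast hψ0
    rw [mul_div_mul_right _ _ hBη, hG, hQ]
    push_cast
    field_simp
    ring
  rw [hval] at hfin
  refine hfin.congr' ?_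
  filter_upwards [eventually_gt_atTop (2 * k)] with n hn
  have hnC : (n : ℂ) ≠ 0 := by exact_mod_cast (by omega : n ≠ 0)
  have hn1C : ((n : ℂ) + 1) ≠ 0 := by exact_mod_cast n.succ_ne_zero
  have haC : (invSqrtCoeff n : ℂ) ≠ 0 := by exact_mod_cast (invSqrtCoeff_pos n).ne'
  have hηn : (η : ℂ) ^ n ≠ 0 := pow_ne_zero n hηC
  have hR : ((PowerSeries.coeff n (R k) : ℝ) : ℂ) =
      -(1 / 8) * PowerSeries.coeff n (A * ((Q : PowerSeries ℂ) * B)) / (n + 1) := by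
    have h1 := hcoefR hn
    push_cast at h1
    rw [eq_div_iff hn1C, mul_comm, h1]
  simp only [Pi.div_apply, Complex.ofReal_div, Complex.ofReal_mul, Complex.ofReal_natCast]
  rw [hcoefL hn, hR, div_div_div_cancel_right₀ haC, mul_div_mul_right _ _ hηn]
  -- If this coefficient vanishes, both quotients are `0` by the convention `x / 0 = 0`, so
  -- nonvanishing of `[zⁿ]R` need not be known.
  by_cases h0 : PowerSeries.coeff n (A * ((Q : PowerSeries ℂ) * B)) = 0
  · simp [h0]
  · field_simp
    ring

end REna

theorem mainTheorem6 (k : ℕ) (hk : 1 ≤ k) :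
    ∃ (η : ℝ) (ψ : ℝ[X]),
      -- `η` is the unique root of `Δ_k` in `]0, 1/√(8k+8)[`
      (η ∈ Set.Ioo 0 (1 / √(8 * (k : ℝ) + 8)) ∧ (REna.Delta k).eval η = 0) ∧
      (∀ x ∈ Set.Ioo 0 (1 / √(8 * (k : ℝ) + 8)), (REna.Delta k).eval x = 0 → x = η) ∧
      -- `ψ` is the cofactor of `1 - z/η` in `Δ_k`
      REna.Delta k = (1 - C η⁻¹ * X) * ψ ∧
      -- the limit is a genuine, nonzero fraction
      ψ.eval η ≠ 0 ∧ (REna.g k).eval η ≠ 0 ∧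
      Tendsto
        (fun n : ℕ => PowerSeries.coeff n (REna.L k) / (n * PowerSeries.coeff n (REna.R k)))
        atTop (𝓝 (4 * k * η ^ 2 * (REna.g k).eval η / ψ.eval η)) := by
  obtain ⟨η, hη, hη0⟩ := REna.exists_root_Delta hk
  obtain ⟨ψ, hψ⟩ := REna.exists_Delta_eq hη.1.ne' hη0
  refine ⟨η, ψ, ⟨hη, hη0⟩, fun x hx hx0 => ?_, hψ, REna.eval_ne_zero_of_Delta_eq hk hη hη0 hψ,
    (REna.eval_g_pos hk hη).ne', REna.tendsto_letters_ratio hk hη hη0 hψ⟩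
  exact Complex.ofReal_injective (REna.eq_of_aeval_Delta_eq_zero hk (REna.norm_ofReal_le_radius hx)
    (REna.norm_ofReal_le_radius hη) (by rw [REna.aeval_ofReal_Delta, hx0, Complex.ofReal_zero])
    (by rw [REna.aeval_ofReal_Delta, hη0, Complex.ofReal_zero]))
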